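/- For $x\in\mathbb{R}$ let $\|x\|_{\mathbb{T}}=|\arg(e^{ix})|$ with $\arg\in(-\pi,\pi]$. Let $X\subset(-\frac{\pi}{2},\frac{\pi}{2}]$ be a set of $n\ge 2$ distinct nodes, let $\Delta=\Delta(X)=\min_{x\ne y\in X}\|x-y\|_{\mathbb{T}}$, and let $V_n(X)=[e^{ikx}]_{k=0,\dots,n-1}^{x\in X}\in\mathbb{C}^{n\times n}$, with singular values $\sigma_1\ge\sigma_2\ge\dots\ge\sigma_n$. We say that $X$ is $((\Delta,\nu^{(j)},n^{(j)})_{j=1}^M,\eta)$-clustered, where $\eta>0$, if $X$ is the disjoint union of nonempty sets $\mathcal{C}^{(1)},\dots,\mathcal{C}^{(M)}$ such that $\#\mathcal{C}^{(j)}=n^{(j)}$, $\Delta\le\|x-y\|_{\mathbb{T}}\le\nu^{(j)}\Delta$ for all distinct $x,y\in\mathcal{C}^{(j)}$, and $\|x-y\|_{\mathbb{T}}\ge\eta$ for all $x\in\mathcal{C}^{(j)}$, $y\in X\setminus\mathcal{C}^{(j)}$. In this case put $s=\max_j n^{(j)}$, $\nu=\max_j\nu^{(j)}$ and $\ell_m=\#\{1\le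 k\le M: m\le n^{(k)}\}$ for $m=1,\dots,s$ (so that $\ell_1+\dots+\ell_s=n$). **Theorem.** For every $s$ there exist constants $C_1,C_2>0$ depending only on $s$, where $C_1$ can be taken below any prescribed $\varepsilon>0$ ($C_2$ may then depend on $s$ and $\varepsilon$), such that the following holds. For every $n\ge2$ and every $\nu$ there is a constant $C>0$, depending only on $s,\varepsilon,n,\nu$ (in particular not on $\Delta$), such that for every set $X$ of $n$ nodes that is $((\Delta,\nu^{(j)},n^{(j)})_{j=1}^M,\eta)$-clustered with $\max_j n^{(j)}=s$, $\max_j\nu^{(j)}=\nu$, $$\eta\ge C_1,\qquad \Delta=\Delta(X)\le\frac{C_2}{n^2\nu},$$ the ordered singular values of $V_n(X)$ split into $s$ consecutive groups, the $m$-th one consisting of precisely $\ell_m$ singular values, and all of those are bounded below by $C\Delta^{m-1}$. That is, for each $m=1,\dots,s$, $$\sigma_i\ge C\,\Delta^{m-1}\quad\text{whenever}\quad \ell_1+\dots+\ell_{m-1}<i\le\ell_1+\dots+\ell_m .$$ -/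

import Mathlib

namespace SuperResolution

noncomputable section

/-- The norm on the torus `ℝ mod 2π`: `‖x‖_𝕋 = |arg (e^{ix})|`, with `arg` in `(-π, π]`. -/
def torusNorm (x : ℝ) : ℝ :=
  |Complex.arg (Complex.exp (Complex.I * (x : ℂ)))|

/-- The minimal separation `Δ(X)`: the minimum (the set is finite, and nonempty as soon as `X` has
two elements) of `‖x - y‖_𝕋` over pairs of distinct nodes. -/
def minSep (X : Finset ℝ) : ℝ :=
  sInf {d : ℝ | ∃ x ∈ X, ∃ y ∈ X, x ≠ y ∧ d = torusNorm (x - y)}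

/-- `S` is an `(h, ν, r)`-cluster. -/
def IsCluster (S : Finset ℝ) (h ν : ℝ) (r : ℕ) : Prop :=
  S.card = r ∧ ∀ x ∈ S, ∀ y ∈ S, x ≠ y → h ≤ torusNorm (y - x) ∧ torusNorm (y - x) ≤ ν * h

/-- `X` forms an `((h_j, ν_j, r_j)_{j < M}, η)`-clustered configuration. -/
def IsClusteredConfiguration (X : Finset ℝ) {M : ℕ} (h ν : Fin M → ℝ) (r : Fin M → ℕ)
    (η : ℝ) : Prop :=
  0 < η ∧
  ∃ 𝒞 : Fin M → Finset ℝ,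
    (∀ j, (𝒞 j).Nonempty) ∧
    (∀ i j, i ≠ j → Disjoint (𝒞 i) (𝒞 j)) ∧
    X = Finset.univ.biUnion 𝒞 ∧
    (∀ j, IsCluster (𝒞 j) (h j) (ν j) (r j)) ∧
    (∀ j, ∀ x ∈ 𝒞 j, ∀ y ∈ X \ 𝒞 j, η ≤ torusNorm (x - y))

/-- The Vandermonde matrix `V(X; S) = [e^{ikx}]`, rows `k ∈ S`, columns `x ∈ X`. -/
def vandermonde (X : Finset ℝ) (S : Finset ℕ) : Matrix S X ℂ :=
  Matrix.of fun k x => Complex.exp (Complex.I * ((k : ℕ) : ℂ) * ((x : ℝ) : ℂ))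

/-- The square Vandermonde matrix `V_n(X) = V(X; {0, …, n - 1})`, where `n` is the number of
nodes. -/
def squareVandermonde (X : Finset ℝ) : Matrix (Finset.range X.card) X ℂ :=
  vandermonde X (Finset.range X.card)

/-- The singular values of a complex matrix, as singular values of the associated map of Euclidean
spaces: in decreasing order and numbered from `0`, so `singularValue A 0` is the largest one. -/
def singularValue {m n : Type*} [Fintype m] [Fintype n] [DecidableEq n] (A : Matrix m n ℂ)
    (i : ℕ) : ℝ :=
  (Matrix.toEuclideanLin A).singularValues i

/-- `ℓ_m = #{k : m ≤ r_k}`, the number of clusters with at least `m` nodes. -/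
def clusterCount {M : ℕ} (r : Fin M → ℕ) (m : ℕ) : ℕ :=
  (Finset.univ.filter fun k => m ≤ r k).card

/-- The `m`-th group of indices (`m ≥ 1`): when `0, 1, 2, …` is cut into consecutive blocks of
lengths `ℓ_1, ℓ_2, …`, this is the `m`-th block. -/
def indexGroup {M : ℕ} (r : Fin M → ℕ) (m : ℕ) : Finset ℕ :=
  Finset.Ico (∑ k ∈ Finset.Ico 1 m, clusterCount r k)
    ((∑ k ∈ Finset.Ico 1 m, clusterCount r k) + clusterCount r m)

/-- The `m`-th group has exactly `ℓ_m` elements. -/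
theorem card_indexGroup {M : ℕ} (r : Fin M → ℕ) (m : ℕ) :
    (indexGroup r m).card = clusterCount r m := by
  simp [indexGroup]

end

end SuperResolution

/-!
The bound rests on the max-min characterization of singular values: `σ_i ≥ c` as soon as
`c ‖v‖ ≤ ‖V v‖` on a subspace of dimension larger than `i` (indices from `0`). For the `m`-th group
of indices, keep `min (m, r_j)` nodes of the `j`-th cluster. The set `Y` of retained nodes has
`∑_j min (m, r_j) = ℓ_1 + ⋯ + ℓ_m` elements, so that the vectors supported on `Y` form a subspace of
the required dimension (`exists_subset_of_cluster`, `le_singularValue_of_forall_support`).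

On that subspace, `V v` determines `v` by Lagrange interpolation. With `z_y = e^{iy}`, let `p_x` be
the polynomial with the simple roots `z_y`, `y ∈ Y \ {x}`. If `v` is supported on `Y`, then
`∑_k coeff_k(p_x) (V v)_k = p_x(z_x) v_x`, and the coefficients of `p_x` are at most `2^{|Y|}`, so
`∏_{y ∈ Y \ {x}} |z_x - z_y| · |v_x|` is bounded by a constant depending on `n` times `‖V v‖`
(`prod_norm_sub_mul_norm_le`). In this product at most `m - 1` factors come from the cluster of
`x`; those are at least `2 Δ / π`, and all the others are at least `2 η / π`. Hence the product is at
least a constant times `Δ ^ (m - 1)`.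

When fewer than `m - 1` factors come from the cluster of `x`, the bound persists because
`Δ / π ≤ 1`. With `C₁ = ε`, the constant is
`C = c ^ n / (2 ^ n n² π ^ s)`, where `c = min (1, 2 ε / π)`.
-/

namespace SuperResolution

open Finset Polynomial

/-! ### A lower bound for singular values -/

/-- One half of the max-min principle: the singular value with index `i` is at least `c` if `T`
expands by the factor `c` on a subspace of dimension larger than `i`. -/
theorem le_singularValues_of_forall_mem {𝕜 E F : Type*} [RCLike 𝕜]
    [NormedAddCommGroup E] [InnerProductSpace 𝕜 E] [FiniteDimensional 𝕜 E]
    [NormedAddCommGroup F] [InnerProductSpace 𝕜 F] [FiniteDimensional 𝕜 F]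
    (T : E →ₗ[𝕜] F) (W : Submodule 𝕜 E) {i : ℕ} (hi : i < Module.finrank 𝕜 W) {c : ℝ}
    (hW : ∀ v ∈ W, c * ‖v‖ ≤ ‖T v‖) : c ≤ T.singularValues i := by
  obtain hc | hc := le_or_gt c 0
  · exact hc.trans (T.singularValues_nonneg i)
  have hT := T.isSymmetric_adjoint_comp_self
  have hin : i < Module.finrank 𝕜 E := hi.trans_le W.finrank_le
  set b := hT.eigenvectorBasis rfl with hb
  -- A nonzero vector of `W` orthogonal to the first `i` eigenvectors of `T† T`.
  let f : W →ₗ[𝕜] (Fin i → 𝕜) :=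
    { toFun := fun w j => b.repr w ⟨j, j.2.trans hin⟩
      map_add' := fun x y => by ext j; simp
      map_smul' := fun a x => by ext j; simp }
  obtain ⟨w, hwf, hw0⟩ := (Submodule.ne_bot_iff _).1
    (LinearMap.ker_ne_bot_of_finrank_lt (f := f) (by simpa using hi))
  have hwz : ∀ j : Fin (Module.finrank 𝕜 E), (j : ℕ) < i → b.repr w j = 0 := fun j hj =>
    congrFun (LinearMap.mem_ker.1 hwf) ⟨j, hj⟩
  have hwpos : 0 < ‖(w : E)‖ := norm_pos_iff.2 (by simpa using hw0)
  have hkey : ‖T w‖ ^ 2 ≤ (T.singularValues i * ‖(w : E)‖) ^ 2 := by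
    have h1 : ‖T w‖ ^ 2 = ∑ j : Fin (Module.finrank 𝕜 E), T.singularValues j ^ 2 * ‖b.repr w j‖ ^ 2 := by
      have h2 : (‖T w‖ ^ 2 : ℝ) = RCLike.re (inner 𝕜 (w : E) ((T.adjoint ∘ₗ T) w)) := by
        rw [LinearMap.comp_apply, LinearMap.adjoint_inner_right, inner_self_eq_norm_sq]
      rw [h2, ← b.repr.inner_map_map, PiLp.inner_apply, map_sum]
      refine Finset.sum_congr rfl fun j _ => ?_
      rw [hb, hT.eigenvectorBasis_apply_self_apply, T.sq_singularValues_fin rfl j,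
        ← smul_eq_mul, inner_smul_right, inner_self_eq_norm_sq_to_K]
      norm_cast
    rw [h1, mul_pow, ← b.repr.norm_map, EuclideanSpace.norm_sq_eq, Finset.mul_sum]
    refine Finset.sum_le_sum fun j _ => ?_
    obtain hj | hj := lt_or_ge (j : ℕ) i
    · simp [hwz j hj]
    · gcongr
      · exact T.singularValues_nonneg _
      · exact T.singularValues_antitone hj
  have h3 := (hW w w.2).trans
    (le_of_sq_le_sq hkey (mul_nonneg (T.singularValues_nonneg i) hwpos.le))
  exact le_of_mul_le_mul_right h3 hwpos

/-- The max-min bound for the coordinate subspace of vectors supported on `Y`. -/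
theorem le_singularValue_of_forall_support {m n : Type*} [Fintype m] [Fintype n] [DecidableEq n]
    (A : Matrix m n ℂ) (Y : Finset n) {i : ℕ} (hi : i < #Y) {c : ℝ}
    (hA : ∀ v : EuclideanSpace ℂ n, (∀ x ∉ Y, v x = 0) →
      c * ‖v‖ ≤ ‖Matrix.toEuclideanLin A v‖) :
    c ≤ singularValue A i := by
  let b := (EuclideanSpace.basisFun n ℂ).toBasis
  have hli : LinearIndependent ℂ fun y : Y => b y :=
    b.linearIndependent.comp _ Subtype.val_injective
  refine le_singularValues_of_forall_mem _ (Submodule.span ℂ (Set.range fun y : Y => b y))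
    (by rw [finrank_span_eq_card hli]; simpa using hi) fun v hv => hA v fun x hx => ?_
  induction hv using Submodule.span_induction with
  | mem v hv =>
    obtain ⟨y, rfl⟩ := hv
    have : x ≠ y := fun h => hx (h ▸ y.2)
    simp [b, this]
  | zero => simp
  | add v w _ _ hv hw => simp [hv, hw]
  | smul a v _ hv => simp [hv]

/-! ### Interpolation estimates -/

theorem norm_coeff_prod_X_sub_C_le {ι : Type*} (s : Finset ι) (z : ι → ℂ)
    (hz : ∀ y, ‖z y‖ ≤ 1) (k : ℕ) : ‖(∏ y ∈ s, (X - C (z y))).coeff k‖ ≤ 2 ^ #s := by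
  classical
  induction s using Finset.induction_on generalizing k with
  | empty =>
    rw [prod_empty, coeff_one]
    split_ifs <;> simp
  | insert a s ha ih =>
    have hstep (w : ℂ) (hw : ‖w‖ ≤ 2 ^ #s) : ‖w * z a‖ ≤ 2 ^ #s := by
      rw [norm_mul]
      exact (mul_le_of_le_one_right (norm_nonneg _) (hz a)).trans hw
    rw [prod_insert ha, mul_comm, card_insert_of_notMem ha, pow_succ, mul_two]
    cases k with
    | zero =>
      rw [mul_coeff_zero]
      simp only [coeff_sub, coeff_X_zero, coeff_C_zero, zero_sub, mul_neg, norm_neg]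
      exact (hstep _ (ih 0)).trans (le_add_of_nonneg_left (by positivity))
    | succ k =>
      rw [coeff_mul_X_sub_C]
      exact (norm_sub_le _ _).trans (add_le_add (ih k) (hstep _ (ih (k + 1))))

/-- Lagrange interpolation recovers the coefficients of an exponential sum with nodes in `Y` from
its first `n ≥ |Y|` moments; multiplying by the product of the node distances keeps the estimate
free of division. -/
theorem prod_norm_sub_mul_norm_le {ι : Type*} [DecidableEq ι] (Y : Finset ι) (z v : ι → ℂ)
    (hz : ∀ y, ‖z y‖ ≤ 1) {n : ℕ} (hn : #Y ≤ n) {x : ι} (hx : x ∈ Y) :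
    (∏ y ∈ Y.erase x, ‖z x - z y‖) * ‖v x‖ ≤
      2 ^ n * ∑ k ∈ range n, ‖∑ y ∈ Y, v y * z y ^ k‖ := by
  set p : ℂ[X] := ∏ y ∈ Y.erase x, (X - C (z y)) with hp
  have hdeg : p.natDegree < n := by
    rw [hp, natDegree_finsetProd_X_sub_C_eq_card]
    exact (card_erase_lt_of_mem hx).trans_le hn
  have hroot (y) (hy : y ∈ Y) (hyx : y ≠ x) : p.eval (z y) = 0 := by
    rw [hp, eval_prod]
    exact prod_eq_zero (mem_erase.2 ⟨hyx, hy⟩) (by simp)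
  have hsum : ∑ k ∈ range n, p.coeff k * ∑ y ∈ Y, v y * z y ^ k = v x * p.eval (z x) := by
    calc _ = ∑ y ∈ Y, v y * p.eval (z y) := by
          simp_rw [eval_eq_sum_range' hdeg, mul_sum]
          rw [sum_comm]
          exact sum_congr rfl fun y _ => sum_congr rfl fun k _ => by ring
      _ = _ := sum_eq_single_of_mem x hx fun y hy hyx => by rw [hroot y hy hyx, mul_zero]
  have heval : ‖p.eval (z x)‖ = ∏ y ∈ Y.erase x, ‖z x - z y‖ := by
    simp [hp, eval_prod, norm_prod]
  rw [← heval, mul_comm, ← norm_mul, ← hsum, mul_sum]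
  refine (norm_sum_le _ _).trans (sum_le_sum fun k _ => ?_)
  rw [norm_mul]
  gcongr
  refine (norm_coeff_prod_X_sub_C_le _ z hz k).trans (pow_le_pow_right₀ one_le_two ?_)
  exact (card_erase_le).trans hn

/-- A lower bound for all products of node distances in `Y` makes the Vandermonde matrix bounded
below on the vectors supported on `Y`. -/
theorem mul_norm_le_norm_squareVandermonde (X : Finset ℝ) (Y : Finset X) {b : ℝ}
    (hb : ∀ x ∈ Y, b ≤ ∏ y ∈ Y.erase x,
      ‖Complex.exp ((x : ℝ) * Complex.I) - Complex.exp ((y : ℝ) * Complex.I)‖)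
    (v : EuclideanSpace ℂ X) (hv : ∀ x ∉ Y, v x = 0) :
    b * ‖v‖ ≤ 2 ^ #X * #X ^ 2 * ‖Matrix.toEuclideanLin (squareVandermonde X) v‖ := by
  set u := Matrix.toEuclideanLin (squareVandermonde X) v with hu
  have hmoment (k : range #X) :
      u k = ∑ y ∈ Y, v y * Complex.exp ((y : ℝ) * Complex.I) ^ (k : ℕ) := by
    rw [hu, Matrix.toLpLin_apply]
    simp only [Matrix.mulVec, dotProduct]
    rw [← sum_subset (subset_univ Y) fun x _ hx => by rw [hv x hx, mul_zero]]
    refine sum_congr rfl fun y _ => ?_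
    rw [← Complex.exp_nat_mul, mul_comm]
    simp only [squareVandermonde, vandermonde, Matrix.of_apply]
    congr 2
    ring
  have hcoord (x : X) : b * ‖v x‖ ≤ 2 ^ #X * (#X * ‖u‖) := by
    by_cases hx : x ∈ Y
    · have hYn : #Y ≤ #X := by simpa using card_le_univ Y
      calc b * ‖v x‖ ≤ _ := mul_le_mul_of_nonneg_right (hb x hx) (norm_nonneg _)
        _ ≤ _ := prod_norm_sub_mul_norm_le Y _ v (fun y => (Complex.norm_exp_ofReal_mul_I y).le)
          hYn hx
        _ ≤ _ := by
          gcongr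
          rw [← sum_coe_sort]
          calc _ = ∑ k : range #X, ‖u k‖ := sum_congr rfl fun k _ => by rw [hmoment k]
            _ ≤ ∑ _k : range #X, ‖u‖ := sum_le_sum fun k _ => PiLp.norm_apply_le u k
            _ = _ := by simp
    · rw [hv x hx, norm_zero, mul_zero]
      positivity
  obtain hb0 | hb0 := le_or_gt b 0
  · exact (mul_nonpos_of_nonpos_of_nonneg hb0 (norm_nonneg _)).trans (by positivity)
  have hnorm : ‖v‖ ≤ ∑ x, ‖v x‖ := by
    have h := norm_sum_le univ fun x => v x • EuclideanSpace.basisFun X ℂ x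
    have h' : ∑ x, v x • EuclideanSpace.basisFun X ℂ x = v :=
      (EuclideanSpace.basisFun X ℂ).sum_repr v
    rw [h'] at h
    simpa [norm_smul] using h
  calc b * ‖v‖ ≤ b * ∑ x, ‖v x‖ := by gcongr
    _ = ∑ x, b * ‖v x‖ := mul_sum _ _ _
    _ ≤ ∑ _x : X, 2 ^ #X * (#X * ‖u‖) := sum_le_sum fun x _ => hcoord x
    _ = _ := by
      simp
      ring

/-! ### Clustered nodes -/

theorem torusNorm_sub_eq_angle (x y : ℝ) :
    torusNorm (x - y) = InnerProductGeometry.angle (Complex.exp ((x : ℝ) * Complex.I))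
      (Complex.exp ((y : ℝ) * Complex.I)) := by
  rw [Complex.angle_eq_abs_arg (Complex.exp_ne_zero _) (Complex.exp_ne_zero _), ← Complex.exp_sub,
    torusNorm]
  congr 3
  push_cast
  ring

theorem mul_torusNorm_le_norm_sub (x y : ℝ) :
    2 / Real.pi * torusNorm (x - y) ≤
      ‖Complex.exp ((x : ℝ) * Complex.I) - Complex.exp ((y : ℝ) * Complex.I)‖ := by
  rw [torusNorm_sub_eq_angle]
  exact Complex.mul_angle_le_norm_sub (Complex.norm_exp_ofReal_mul_I x)
    (Complex.norm_exp_ofReal_mul_I y)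

theorem minSep_nonneg (X : Finset ℝ) : 0 ≤ minSep X := by
  refine Real.sInf_nonneg ?_
  rintro d ⟨x, _, y, _, _, rfl⟩
  exact abs_nonneg _

theorem minSep_le_pi (X : Finset ℝ) : minSep X ≤ Real.pi := by
  by_cases h : ∃ x ∈ X, ∃ y ∈ X, x ≠ y
  · obtain ⟨x, hx, y, hy, hxy⟩ := h
    have hbdd : BddBelow {d : ℝ | ∃ x ∈ X, ∃ y ∈ X, x ≠ y ∧ d = torusNorm (x - y)} := by
      refine ⟨0, ?_⟩
      rintro d ⟨x, _, y, _, _, rfl⟩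
      exact abs_nonneg _
    exact (csInf_le hbdd ⟨x, hx, y, hy, hxy, rfl⟩).trans (Complex.abs_arg_le_pi _)
  · have : {d : ℝ | ∃ x ∈ X, ∃ y ∈ X, x ≠ y ∧ d = torusNorm (x - y)} = ∅ := by
      refine Set.eq_empty_of_forall_notMem ?_
      rintro d ⟨x, hx, y, hy, hxy, _⟩
      exact h ⟨x, hx, y, hy, hxy⟩
    rw [minSep, this, Real.sInf_empty]
    exact Real.pi_pos.le

/-- The Young-diagram identity `ℓ_1 + ⋯ + ℓ_m = ∑_j min (m, r_j)`. -/
theorem sum_clusterCount {M : ℕ} (r : Fin M → ℕ) (m : ℕ) :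
    ∑ k ∈ Ico 1 (m + 1), clusterCount r k = ∑ j, min m (r j) := by
  simp_rw [clusterCount, card_filter]
  rw [sum_comm]
  refine sum_congr rfl fun j _ => ?_
  rw [← card_filter]
  have : (Ico 1 (m + 1)).filter (fun k => k ≤ r j) = Icc 1 (min m (r j)) := by
    ext k
    simp only [mem_filter, mem_Ico, mem_Icc]
    omega
  rw [this, Nat.card_Icc]
  omega

/-- Retaining `min (m, r_j)` nodes of each cluster gives `ℓ_1 + ⋯ + ℓ_m` nodes, each of which has
at most `m - 1` retained neighbours in its own cluster. -/
theorem exists_subset_of_cluster {X : Finset ℝ} {M : ℕ} {νs : Fin M → ℝ} {r : Fin M → ℕ} {η : ℝ}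
    (h : IsClusteredConfiguration X (fun _ => minSep X) νs r η) {m : ℕ} (hm : 1 ≤ m)
    {c : ℝ} (hc0 : 0 ≤ c) (hc1 : c ≤ 1) (hcη : c ≤ 2 / Real.pi * η) :
    ∃ Y : Finset X, #Y = ∑ k ∈ Ico 1 (m + 1), clusterCount r k ∧
      ∀ x ∈ Y, c ^ #X * (minSep X / Real.pi) ^ (m - 1) ≤ ∏ y ∈ Y.erase x,
        ‖Complex.exp ((x : ℝ) * Complex.I) - Complex.exp ((y : ℝ) * Complex.I)‖ := by
  obtain ⟨-, 𝒞, -, hdisj, hX, hcl, hsep⟩ := h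
  set δ := minSep X / Real.pi with hδ
  have hδ0 : 0 ≤ δ := div_nonneg (minSep_nonneg X) Real.pi_pos.le
  have hδ1 : δ ≤ 1 := (div_le_one Real.pi_pos).2 (minSep_le_pi X)
  have hsub (j) : 𝒞 j ⊆ X := hX ▸ subset_biUnion_of_mem 𝒞 (mem_univ j)
  let D (j : Fin M) : Finset X := (𝒞 j).subtype (· ∈ X)
  have hD (j) : #(D j) = r j := by
    rw [card_subtype, filter_true_of_mem fun x hx => hsub j hx]
    exact (hcl j).1
  choose T hTD hT using fun j => exists_subset_card_eq ((min_le_right m (r j)).trans (hD j).ge)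
  have hTC {j} {x : X} (hx : x ∈ T j) : (x : ℝ) ∈ 𝒞 j := by simpa [D] using hTD j hx
  have hTdisj : ∀ i j, i ≠ j → Disjoint (T i) (T j) := fun i j hij =>
    disjoint_left.2 fun x hxi hxj => disjoint_left.1 (hdisj i j hij) (hTC hxi) (hTC hxj)
  refine ⟨univ.biUnion T, ?_, fun x hx => ?_⟩
  · rw [card_biUnion fun i _ j _ hij => hTdisj i j hij, sum_clusterCount]
    exact sum_congr rfl fun j _ => hT j
  obtain ⟨j, -, hxj⟩ := mem_biUnion.1 hx
  set Y := univ.biUnion T with hY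
  have hfactor (y) (hy : y ∈ Y.erase x) : c * (if y ∈ T j then δ else 1) ≤
      ‖Complex.exp ((x : ℝ) * Complex.I) - Complex.exp ((y : ℝ) * Complex.I)‖ := by
    obtain ⟨hyx, hyY⟩ := mem_erase.1 hy
    refine le_trans ?_ (mul_torusNorm_le_norm_sub _ _)
    split_ifs with hyj
    · have hΔ : minSep X ≤ torusNorm ((x : ℝ) - y) :=
        ((hcl j).2 y (hTC hyj) x (hTC hxj) fun h => hyx (Subtype.ext h)).1
      calc c * δ ≤ 1 * δ := by gcongr
        _ ≤ 2 * δ := by gcongr; norm_num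
        _ = 2 / Real.pi * minSep X := by rw [hδ]; ring
        _ ≤ _ := by gcongr
    · obtain ⟨i, -, hyi⟩ := mem_biUnion.1 hyY
      have hij : i ≠ j := fun h => hyj (h ▸ hyi)
      have hyC : (y : ℝ) ∉ 𝒞 j := disjoint_left.1 (hdisj i j hij) (hTC hyi)
      have hη := hsep j x (hTC hxj) y (mem_sdiff.2 ⟨y.2, hyC⟩)
      rw [mul_one]
      exact hcη.trans (by gcongr)
  refine le_trans ?_ (prod_le_prod (fun y _ => ?_) hfactor)
  · rw [prod_mul_distrib, prod_const, prod_ite, prod_const, prod_const, one_pow, mul_one]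
    have h1 : #(Y.erase x) ≤ #X := by simpa using card_le_univ (Y.erase x)
    have h2 : #((Y.erase x).filter (· ∈ T j)) ≤ m - 1 := by
      calc _ ≤ #((T j).erase x) := card_le_card fun y hy => by
            simp only [mem_filter, mem_erase] at hy ⊢
            exact ⟨hy.1.1, hy.2⟩
        _ = min m (r j) - 1 := by rw [card_erase_of_mem hxj, hT j]
        _ ≤ _ := by omega
    exact mul_le_mul (pow_le_pow_of_le_one hc0 hc1 h1) (pow_le_pow_of_le_one hδ0 hδ1 h2)
      (by positivity) (by positivity)
  · split_ifs <;> positivity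

end SuperResolution

theorem mainTheorem3 (s : ℕ) (ε : ℝ) (hε : 0 < ε) :
    ∃ C₁ C₂ : ℝ, 0 < C₁ ∧ C₁ ≤ ε ∧ 0 < C₂ ∧
      ∀ (n : ℕ) (ν : ℝ), 2 ≤ n →
        ∃ C : ℝ, 0 < C ∧
          ∀ (X : Finset ℝ), X.card = n →
            (∀ x ∈ X, x ∈ Set.Ioc (-(Real.pi / 2)) (Real.pi / 2)) →
          ∀ (M : ℕ) (νs : Fin M → ℝ) (r : Fin M → ℕ) (η : ℝ),
            SuperResolution.IsClusteredConfiguration X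
              (fun _ => SuperResolution.minSep X) νs r η →
            IsGreatest (Set.range r) s →
            IsGreatest (Set.range νs) ν →
            C₁ ≤ η →
            SuperResolution.minSep X ≤ C₂ / ((n : ℝ) ^ 2 * ν) →
            ∀ m ∈ Finset.Icc 1 s, ∀ i ∈ SuperResolution.indexGroup r m,
              C * SuperResolution.minSep X ^ (m - 1) ≤
                SuperResolution.singularValue (SuperResolution.squareVandermonde X) i := by
  set c := min 1 (2 / Real.pi * ε) with hc
  have hc0 : 0 < c := lt_min one_pos (by positivity)
  refine ⟨ε, 1, hε, le_rfl, one_pos, fun n ν hn => ?_⟩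
  -- The powers of `2` and `n` come from the interpolation estimate; `π ^ s` pays for replacing the
  -- normalized separation `Δ / π ≤ 1` by `Δ`.
  refine ⟨c ^ n / (2 ^ n * n ^ 2 * Real.pi ^ s), by positivity, ?_⟩
  rintro X rfl - M νs r η hX - - hη - m hm i hi
  obtain ⟨hm1, hms⟩ := Finset.mem_Icc.1 hm
  have hcη : c ≤ 2 / Real.pi * η := (min_le_right _ _).trans (by gcongr)
  obtain ⟨Y, hYcard, hY⟩ := SuperResolution.exists_subset_of_cluster hX hm1 hc0.le
    (min_le_left _ _) hcη
  have hiY : i < Y.card := by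
    rw [hYcard, Finset.sum_Ico_succ_top hm1]
    exact (Finset.mem_Ico.1 hi).2
  refine SuperResolution.le_singularValue_of_forall_support _ Y hiY fun v hv => ?_
  have key := SuperResolution.mul_norm_le_norm_squareVandermonde X Y hY v hv
  have hΔ := SuperResolution.minSep_nonneg X
  have hpi : Real.pi ^ (m - 1) ≤ Real.pi ^ s :=
    pow_le_pow_right₀ (by linarith [Real.pi_gt_three]) (by omega)
  have hK : (0 : ℝ) < 2 ^ X.card * X.card ^ 2 := by positivity
  calc _ = c ^ X.card * (SuperResolution.minSep X ^ (m - 1) / Real.pi ^ s) * ‖v‖ /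
        (2 ^ X.card * X.card ^ 2) := by
        field_simp
    _ ≤ c ^ X.card * (SuperResolution.minSep X / Real.pi) ^ (m - 1) * ‖v‖ /
        (2 ^ X.card * X.card ^ 2) := by
        rw [div_pow]
        gcongr
    _ ≤ _ := (div_le_iff₀' hK).2 key
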